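/- \textbf{Setting.} Let $F:\mathcal X\to\mathbb R^{n_2}$ be a feature embedding, $x_1,\dots,x_m\in\mathcal X$ training instances with labels $y_1,\dots,y_m\in\mathcal Y$, and $(x,y)\in\mathcal X\times\mathcal Y$ a test instance with its true label. Let $0\le n_3<n_2$ be integers. Distances in $\mathbb R^{n_2}$ are Euclidean. Assume that some training label differs from $y$, let $r=\min\{\|F(x)-F(x_i)\| : y_i\ne y\}$ be the shortest distance between $F(x)$ and a training feature of a different class, and assume $r>0$. The classifier $\textsc{RobustClassifier}(\tau,\sigma)$ first deletes every training example $i$ for which some $j$ with $y_j\ne y_i$ satisfies $\|F(x_i)-F(x_j)\|<\sigma$. On input $e\in\mathbb R^{n_2}$, it returns the label of a remaining training feature nearest to $e$ (ties broken arbitrarily) if the distance from $e$ to that feature is less than $\tau$; otherwise it abstains. (For $\sigma=0$ nothing is deleted.) Let $S$ be a uniformly random $n_3$-dimensional linear subspace of $\mathbb R^{n_2}$ (the image of a fixed $n_3$-dimensional subspace under a Haar-random orthogonal transformation). The robust error of a classifier $f$ at $x$ is $$\mathcal E^{x}_{\mathrm{adv}}(f)=\Pr_S\bigl[\exists\, e\in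 S+F(x):\ f(e)\ne y\ \text{and}\ f(e)\ \text{does not abstain}\bigr].$$ \textbf{Theorem.} There are absolute constants $c>0$ and $0<c_0<1$ such that, for all data as above and every threshold $\tau\ge 0$ (in particular when $\tau=o\bigl(r\sqrt{1-n_3/n_2}\bigr)$), the robust error of $\textsc{RobustClassifier}(\tau,0)$ satisfies $$\mathcal E^{x}_{\mathrm{adv}}\bigl(\textsc{RobustClassifier}(\tau,0)\bigr)\ \le\ m\left(\frac{c\,\tau}{r\sqrt{1-\frac{n_3}{n_2}}}\right)^{n_2-n_3}+m\,c_0^{\,n_2-n_3}.$$ -/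

import Mathlib

open MeasureTheory

noncomputable section

/-- The feature space `ℝⁿ` with the Euclidean norm. -/
abbrev Feat (n : ℕ) := EuclideanSpace ℝ (Fin n)

/-- The Grassmannian of `k`-dimensional linear subspaces of `ℝⁿ`. -/
abbrev Grass (n k : ℕ) := {S : Submodule ℝ (Feat n) // Module.finrank ℝ S = k}

/-- The topology of the Grassmannian: a subspace is identified with its orthogonal projection. -/
instance Grass.topology (n k : ℕ) : TopologicalSpace (Grass n k) :=
  TopologicalSpace.induced (fun S => S.1.starProjection) inferInstance

instance Grass.measurable (n k : ℕ) : MeasurableSpace (Grass n k) := borel _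

instance Grass.borel (n k : ℕ) : BorelSpace (Grass n k) := ⟨rfl⟩

/-- The orthogonal group `O(n)`, as the group of unitary operators on `ℝⁿ`. -/
abbrev OrthGroup (n : ℕ) := unitary (Feat n →L[ℝ] Feat n)

instance Feat.continuousStar (n : ℕ) : ContinuousStar (Feat n →L[ℝ] Feat n) :=
  ⟨(ContinuousLinearMap.adjoint (𝕜 := ℝ) (E := Feat n) (F := Feat n)).continuous⟩

instance OrthGroup.compact (n : ℕ) : CompactSpace (OrthGroup n) := by
  suffices h : IsCompact (unitary (Feat n →L[ℝ] Feat n) : Set (Feat n →L[ℝ] Feat n)) from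
    isCompact_iff_compactSpace.mp h
  apply Metric.isCompact_of_isClosed_isBounded
  · exact isClosed_unitary
  · refine (Metric.isBounded_closedBall (x := (0 : Feat n →L[ℝ] Feat n)) (r := 1)).subset ?_
    intro U hU
    rw [mem_closedBall_zero_iff]
    refine ContinuousLinearMap.opNorm_le_bound _ zero_le_one fun x => ?_
    rw [one_mul]
    exact ((Unitary.linearIsometryEquiv ⟨U, hU⟩).norm_map x).le

/-- The normalized Haar measure on `O(n)`. -/
def orthHaar (n : ℕ) : Measure (OrthGroup n) := Measure.haarMeasure ⊤

/-- The span of the first `k` standard basis vectors of `ℝⁿ`. -/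
def coordSubspace (n k : ℕ) : Submodule ℝ (Feat n) :=
  Submodule.span ℝ {v | ∃ i : Fin n, i.val < k ∧ v = EuclideanSpace.single i (1 : ℝ)}

theorem finrank_coordSubspace {n k : ℕ} (h : k ≤ n) :
    Module.finrank ℝ (coordSubspace n k) = k := by
  have hs : {v : Feat n | ∃ i : Fin n, i.val < k ∧ v = EuclideanSpace.single i (1 : ℝ)}
      = Set.range (fun j : Fin k => EuclideanSpace.single (Fin.castLE h j) (1 : ℝ)) := by
    ext v
    constructor
    · rintro ⟨i, hi, rfl⟩
      exact ⟨⟨i, hi⟩, rfl⟩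
    · rintro ⟨j, rfl⟩
      exact ⟨Fin.castLE h j, j.2, rfl⟩
  have hli : LinearIndependent ℝ
      (fun j : Fin k => (EuclideanSpace.single (Fin.castLE h j) (1 : ℝ) : Feat n)) := by
    have := (EuclideanSpace.basisFun (Fin n) ℝ).orthonormal.linearIndependent.comp
      (Fin.castLE h) (Fin.castLE_injective h)
    simpa [Function.comp_def] using this
  rw [coordSubspace, hs, finrank_span_eq_card hli, Fintype.card_fin]

/-- The image of the coordinate subspace under an orthogonal transformation. -/
def rotatedSubspace {n k : ℕ} (h : k ≤ n) (U : OrthGroup n) : Grass n k :=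
  ⟨(coordSubspace n k).map (Unitary.linearIsometryEquiv U).toLinearEquiv.toLinearMap, by
    rw [LinearEquiv.finrank_map_eq, finrank_coordSubspace h]⟩

theorem continuous_rotatedSubspace {n k : ℕ} (h : k ≤ n) :
    Continuous (rotatedSubspace h : OrthGroup n → Grass n k) := by
  rw [continuous_induced_rng]
  have : ((fun S : Grass n k => S.1.starProjection) ∘ rotatedSubspace h)
      = fun U : OrthGroup n => (U : Feat n →L[ℝ] Feat n) * (coordSubspace n k).starProjection
          * ((U⁻¹ : OrthGroup n) : Feat n →L[ℝ] Feat n) := by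
    funext U
    ext1 x
    exact Submodule.starProjection_map_apply (Unitary.linearIsometryEquiv U)
      (coordSubspace n k) x
  rw [this]
  exact (continuous_subtype_val.mul continuous_const).mul
    (continuous_subtype_val.comp continuous_inv)

/-- The uniform distribution on the `k`-dimensional subspaces of `ℝⁿ`: the law of the image of a
fixed `k`-dimensional subspace under a Haar-random orthogonal transformation. -/
def uniformSubspace {n k : ℕ} (h : k ≤ n) : Measure (Grass n k) :=
  (orthHaar n).map (rotatedSubspace h)

instance uniformSubspace.isProbabilityMeasure {n k : ℕ} (h : k ≤ n) :
    IsProbabilityMeasure (uniformSubspace h) := by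
  have : IsProbabilityMeasure (orthHaar n) := ⟨by
    have := Measure.haarMeasure_self (K₀ := (⊤ : TopologicalSpace.PositiveCompacts (OrthGroup n)))
    simpa [orthHaar] using this⟩
  exact Measure.isProbabilityMeasure_map (continuous_rotatedSubspace h).measurable.aemeasurable

/-- Training example `i` survives the preprocessing with separation parameter `σ`: no training
feature with another label lies at distance less than `σ`. -/
def Kept {n m : ℕ} {𝒴 : Type*} (σ : ℝ) (z : Fin m → Feat n) (lab : Fin m → 𝒴) (i : Fin m) : Prop :=
  ∀ j, lab i ≠ lab j → ¬ dist (z i) (z j) < σ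

/-- `f` is an implementation of `RobustClassifier(τ, σ)` for the training features `z` with labels
`lab`. The output `none` means "don't know". If some surviving training feature is at distance less
than `τ`, the label of a nearest surviving training feature is returned (ties are broken
arbitrarily); otherwise the classifier abstains. -/
structure IsRobustClassifier {n m : ℕ} {𝒴 : Type*} (τ σ : ℝ) (z : Fin m → Feat n)
    (lab : Fin m → 𝒴) (f : Feat n → Option 𝒴) : Prop where
  predicts : ∀ e, (∃ i, Kept σ z lab i ∧ dist e (z i) < τ) →
    ∃ i, Kept σ z lab i ∧ (∀ j, Kept σ z lab j → dist e (z i) ≤ dist e (z j)) ∧ f e = some (lab i)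
  abstains : ∀ e, (¬ ∃ i, Kept σ z lab i ∧ dist e (z i) < τ) → f e = none

/-- The robust error of `f` at the feature vector `p` with label `y`, against an adversary that
moves `p` arbitrarily inside `S + p`, where the subspace `S` has law `P`: the probability that
some `e ∈ S + p` gets a label other than `y`. -/
def robustError {n k : ℕ} {𝒴 : Type*} (P : Measure (Grass n k)) (f : Feat n → Option 𝒴)
    (p : Feat n) (y : 𝒴) : ℝ :=
  P.real {S | ∃ v ∈ S.1, f (v + p) ≠ some y ∧ f (v + p) ≠ none}

end

noncomputable section

/-! A wrong answer on `F x + S` puts some differently labelled `F (train i)` within `τ` of it, so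
`S` comes within `τ` of `w = F (train i) - F x`, where `‖w‖ ≥ r`. A union bound over `i` leaves one
estimate for a fixed `w`. Rotating back, it says that a uniform unit vector rarely has `tailSq`
below `(τ / r) ^ 2`.

The unit vector is replaced by a Gaussian one: by homogeneity the event becomes `tailSq k g < x *
‖g‖ ^ 2`, and a Chernoff bound reduces it to a product of one-dimensional Gaussian integrals
(`orthHaar_tailSq_lt_le_prod`). A choice of the Chernoff parameter gives
`orthHaar_tailSq_lt_le_pow`. -/

theorem lintegral_exp_neg_weighted_sum_sq {n : ℕ} (w : Fin n → ℝ) (hw : ∀ i, 0 < w i) :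
    ∫⁻ g : Feat n, ENNReal.ofReal (Real.exp (-∑ i, w i * g i ^ 2))
      = ENNReal.ofReal (∏ i, √(Real.pi / w i)) := by
  have hexp : ∀ g : Fin n → ℝ, Real.exp (-∑ i, w i * g i ^ 2)
      = ∏ i, Real.exp (-w i * g i ^ 2) := fun g => by
    rw [← Real.exp_sum, ← Finset.sum_neg_distrib]
    simp only [neg_mul]
  have hmp := PiLp.volume_preserving_ofLp (Fin n)
  have h1 : ∫⁻ g : Feat n, ENNReal.ofReal (Real.exp (-∑ i, w i * g i ^ 2))
      = ∫⁻ g : Fin n → ℝ, ENNReal.ofReal (∏ i, Real.exp (-w i * g i ^ 2)) := by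
    rw [← hmp.lintegral_comp (by fun_prop)]
    exact lintegral_congr fun g => by rw [← hexp]
  rw [h1, volume_pi, ← ofReal_integral_eq_lintegral_ofReal
    (Integrable.fintype_prod (f := fun i (x : ℝ) => Real.exp (-w i * x ^ 2))
      fun i => integrable_exp_neg_mul_sq (hw i))
    (Filter.Eventually.of_forall fun g => Finset.prod_nonneg fun i _ => (Real.exp_pos _).le),
    integral_fintype_prod_eq_prod (fun i (x : ℝ) => Real.exp (-w i * x ^ 2))]
  simp only [integral_gaussian]

/-- The squared norm of the components of `g` with index at least `k`. -/
def tailSq {n : ℕ} (k : ℕ) (g : Feat n) : ℝ :=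
  ∑ i : Fin n, if (i : ℕ) < k then 0 else g i ^ 2

theorem continuous_tailSq (n k : ℕ) : Continuous (tailSq k : Feat n → ℝ) := by
  refine continuous_finsetSum _ fun i _ => ?_
  split_ifs <;> fun_prop

theorem tailSq_smul {n : ℕ} (k : ℕ) (a : ℝ) (g : Feat n) :
    tailSq k (a • g) = a ^ 2 * tailSq k g := by
  simp only [tailSq, Finset.mul_sum, PiLp.smul_apply, smul_eq_mul, mul_pow, mul_ite, mul_zero]

theorem tailSq_le_norm_sq {n : ℕ} (k : ℕ) (g : Feat n) : tailSq k g ≤ ‖g‖ ^ 2 := by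
  rw [EuclideanSpace.real_norm_sq_eq]
  refine Finset.sum_le_sum fun i _ => ?_
  split_ifs
  · positivity
  · exact le_rfl

theorem apply_eq_zero_of_mem_coordSubspace {n k : ℕ} {v : Feat n} (hv : v ∈ coordSubspace n k)
    (i : Fin n) (hi : k ≤ i) : v i = 0 := by
  induction hv using Submodule.span_induction with
  | mem v hv =>
    obtain ⟨j, hj, rfl⟩ := hv
    have : i ≠ j := by rintro rfl; omega
    simp [this]
  | zero => rfl
  | add v w _ _ hv hw => simp [hv, hw]
  | smul a v _ hv => simp [hv]

theorem tailSq_le_norm_sub_sq {n k : ℕ} (g : Feat n) {v : Feat n} (hv : v ∈ coordSubspace n k) :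
    tailSq k g ≤ ‖g - v‖ ^ 2 := by
  have : tailSq k g = tailSq k (g - v) := by
    refine Finset.sum_congr rfl fun i _ => ?_
    split_ifs with h
    · rfl
    · simp [apply_eq_zero_of_mem_coordSubspace hv i (not_lt.mp h)]
  exact this ▸ tailSq_le_norm_sq k _

/-! ### Haar measure on the orthogonal group -/

instance OrthGroup.secondCountable (n : ℕ) : SecondCountableTopology (OrthGroup n) :=
  haveI : SecondCountableTopology (Feat n →L[ℝ] Feat n) := secondCountable_of_proper
  inferInstance

instance orthHaar.isProbabilityMeasure (n : ℕ) : IsProbabilityMeasure (orthHaar n) := ⟨by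
  have := Measure.haarMeasure_self (K₀ := (⊤ : TopologicalSpace.PositiveCompacts (OrthGroup n)))
  simpa [orthHaar] using this⟩

instance orthHaar.isMulLeftInvariant (n : ℕ) : (orthHaar n).IsMulLeftInvariant :=
  inferInstanceAs (Measure.haarMeasure ⊤).IsMulLeftInvariant

theorem continuous_orthGroup_inv_apply (n : ℕ) :
    Continuous fun p : OrthGroup n × Feat n => ((p.1⁻¹ : OrthGroup n) : Feat n →L[ℝ] Feat n) p.2 :=
  (continuous_subtype_val.comp (continuous_inv.comp continuous_fst)).clm_apply continuous_snd

theorem exists_orthGroup_apply_eq {n : ℕ} {u v : Feat n} (h : ‖u‖ = ‖v‖) :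
    ∃ V : OrthGroup n, (V : Feat n →L[ℝ] Feat n) u = v :=
  ⟨Unitary.linearIsometryEquiv.symm (Submodule.reflection (ℝ ∙ (u - v))ᗮ),
    Submodule.reflection_sub h⟩

/-- Some reflection `V` sends `v` to `u`, and left invariance allows `U` to be replaced by `V * U`.
-/
theorem orthHaar_inv_apply_eq {n : ℕ} {u v : Feat n} (h : ‖u‖ = ‖v‖) (A : Set (Feat n)) :
    orthHaar n {U | ((U⁻¹ : OrthGroup n) : Feat n →L[ℝ] Feat n) u ∈ A}
      = orthHaar n {U | ((U⁻¹ : OrthGroup n) : Feat n →L[ℝ] Feat n) v ∈ A} := by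
  obtain ⟨V, hV⟩ := exists_orthGroup_apply_eq h.symm
  rw [← measure_preimage_mul (orthHaar n) V]
  congr 1
  ext U
  have : (((V * U)⁻¹ : OrthGroup n) : Feat n →L[ℝ] Feat n) u
      = ((U⁻¹ : OrthGroup n) : Feat n →L[ℝ] Feat n) v := by
    rw [mul_inv_rev, ← hV]
    change ((U⁻¹ * V⁻¹ * V : OrthGroup n) : Feat n →L[ℝ] Feat n) v = _
    rw [inv_mul_cancel_right]
  simp only [Set.mem_preimage, Set.mem_ofPred_eq, this]

theorem measurable_tailSq_orthGroup_inv_apply {n : ℕ} (k : ℕ) (g : Feat n) :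
    Measurable fun U : OrthGroup n =>
      tailSq k (((U⁻¹ : OrthGroup n) : Feat n →L[ℝ] Feat n) g) := by
  have h : Continuous fun U : OrthGroup n => ((U⁻¹ : OrthGroup n) : Feat n →L[ℝ] Feat n) g :=
    (continuous_subtype_val.comp continuous_inv).clm_apply continuous_const
  exact ((continuous_tailSq n k).comp h).measurable

/-! ### Gaussian comparison and Chernoff bound -/

/-- Invariance moves `u` to `g / ‖g‖`, and `tailSq` is homogeneous of degree 2. The non-strict
inequality on the right also covers `g = 0`. -/
theorem orthHaar_tailSq_lt_le_of_norm_eq_one {n : ℕ} (k : ℕ) {u : Feat n} (hu : ‖u‖ = 1)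
    (x : ℝ) (g : Feat n) :
    orthHaar n {U | tailSq k (((U⁻¹ : OrthGroup n) : Feat n →L[ℝ] Feat n) u) < x}
      ≤ orthHaar n {U | tailSq k (((U⁻¹ : OrthGroup n) : Feat n →L[ℝ] Feat n) g)
          ≤ x * ‖g‖ ^ 2} := by
  by_cases hg : g = 0
  · refine prob_le_one.trans_eq ?_
    have : {U : OrthGroup n | tailSq k (((U⁻¹ : OrthGroup n) : Feat n →L[ℝ] Feat n) g)
        ≤ x * ‖g‖ ^ 2} = Set.univ := by
      ext U
      simp [hg, tailSq]
    rw [this, measure_univ]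
  · have hg' : 0 < ‖g‖ := norm_pos_iff.mpr hg
    have := orthHaar_inv_apply_eq (u := u) (v := ‖g‖⁻¹ • g)
      (by rw [hu, norm_smul, norm_inv, norm_norm, inv_mul_cancel₀ hg'.ne']) {h | tailSq k h < x}
    simp only [Set.mem_ofPred_eq] at this
    rw [this]
    refine measure_mono fun U hU => ?_
    simp only [Set.mem_ofPred_eq, map_smul, tailSq_smul] at hU ⊢
    rw [inv_pow, inv_mul_lt_iff₀ (by positivity), mul_comm] at hU
    exact hU.le

theorem orthHaar_tailSq_lt_mul_le_lintegral {n : ℕ} (k : ℕ) {u : Feat n} (hu : ‖u‖ = 1)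
    {s : ℝ} (hs : 0 ≤ s) (x : ℝ) (g : Feat n) :
    orthHaar n {U | tailSq k (((U⁻¹ : OrthGroup n) : Feat n →L[ℝ] Feat n) u) < x}
        * ENNReal.ofReal (Real.exp (-‖g‖ ^ 2))
      ≤ ∫⁻ U : OrthGroup n, ENNReal.ofReal (Real.exp (s * (x * ‖g‖ ^ 2
          - tailSq k (((U⁻¹ : OrthGroup n) : Feat n →L[ℝ] Feat n) g)) - ‖g‖ ^ 2))
          ∂(orthHaar n) := by
  have hm := measurableSet_le (measurable_tailSq_orthGroup_inv_apply k g)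
    (measurable_const (a := x * ‖g‖ ^ 2))
  refine (mul_le_mul_left (orthHaar_tailSq_lt_le_of_norm_eq_one k hu x g) _).trans ?_
  rw [mul_comm, ← setLIntegral_const]
  refine (setLIntegral_mono' hm fun U hU => ?_).trans (setLIntegral_le_lintegral _ _)
  refine ENNReal.ofReal_le_ofReal (Real.exp_le_exp.mpr ?_)
  have := mul_nonneg hs (sub_nonneg.mpr hU)
  linarith

/-- Integrate the pointwise Chernoff bound over `g` and swap the integrals; rotation invariance of
Lebesgue measure then removes `U`. -/
theorem orthHaar_tailSq_lt_mul_le {n : ℕ} (k : ℕ) {u : Feat n} (hu : ‖u‖ = 1) {s : ℝ}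
    (hs : 0 ≤ s) (x : ℝ) :
    orthHaar n {U | tailSq k (((U⁻¹ : OrthGroup n) : Feat n →L[ℝ] Feat n) u) < x}
        * ∫⁻ g : Feat n, ENNReal.ofReal (Real.exp (-‖g‖ ^ 2))
      ≤ ∫⁻ g : Feat n, ENNReal.ofReal (Real.exp (s * (x * ‖g‖ ^ 2 - tailSq k g) - ‖g‖ ^ 2)) := by
  let φ : Feat n → ENNReal :=
    fun g => ENNReal.ofReal (Real.exp (s * (x * ‖g‖ ^ 2 - tailSq k g) - ‖g‖ ^ 2))
  have hcφ : Continuous φ := by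
    have := continuous_tailSq n k
    exact ENNReal.continuous_ofReal.comp (by fun_prop)
  have hrot : ∀ U : OrthGroup n, ∫⁻ g, φ (((U⁻¹ : OrthGroup n) : Feat n →L[ℝ] Feat n) g)
      = ∫⁻ g, φ g := fun U =>
    ((Unitary.linearIsometryEquiv U⁻¹).measurePreserving).lintegral_comp hcφ.measurable
  have hpt : ∀ g : Feat n,
      orthHaar n {U | tailSq k (((U⁻¹ : OrthGroup n) : Feat n →L[ℝ] Feat n) u) < x}
        * ENNReal.ofReal (Real.exp (-‖g‖ ^ 2))
      ≤ ∫⁻ U : OrthGroup n, φ (((U⁻¹ : OrthGroup n) : Feat n →L[ℝ] Feat n) g) ∂(orthHaar n) := by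
    intro g
    refine (orthHaar_tailSq_lt_mul_le_lintegral k hu hs x g).trans_eq ?_
    refine lintegral_congr fun U => ?_
    have hnorm := Unitary.norm_map U⁻¹ g
    simp only [φ, hnorm]
  rw [← lintegral_const_mul _ (by fun_prop)]
  refine (lintegral_mono hpt).trans_eq ?_
  rw [lintegral_lintegral_swap
    (f := fun g (U : OrthGroup n) => φ (((U⁻¹ : OrthGroup n) : Feat n →L[ℝ] Feat n) g))
    (hcφ.comp ((continuous_orthGroup_inv_apply n).comp continuous_swap)).measurable.aemeasurable]
  simp only [hrot, lintegral_const, measure_univ, mul_one]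
  rfl

/-- Both integrals are Gaussian with diagonal weights, positive because `s * x < 1`; the factors
`√π` cancel. -/
theorem orthHaar_tailSq_lt_le_prod {n : ℕ} (k : ℕ) {u : Feat n} (hu : ‖u‖ = 1) {s x : ℝ}
    (hs : 0 ≤ s) (hsx : s * x < 1) :
    (orthHaar n).real {U | tailSq k (((U⁻¹ : OrthGroup n) : Feat n →L[ℝ] Feat n) u) < x}
      ≤ ∏ i : Fin n, √((1 - s * x + if (i : ℕ) < k then 0 else s)⁻¹) := by
  have hw : ∀ i : Fin n, 0 < 1 - s * x + if (i : ℕ) < k then 0 else s := by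
    intro i
    split_ifs <;> linarith
  have h := orthHaar_tailSq_lt_mul_le k hu hs x
  have e1 : ∀ g : Feat n, -‖g‖ ^ 2 = -∑ i, (1 : ℝ) * g i ^ 2 := fun g => by
    simp [EuclideanSpace.real_norm_sq_eq]
  have e2 : ∀ g : Feat n, s * (x * ‖g‖ ^ 2 - tailSq k g) - ‖g‖ ^ 2
      = -∑ i : Fin n, (1 - s * x + if (i : ℕ) < k then 0 else s) * g i ^ 2 := fun g => by
    have : tailSq k g = ∑ i : Fin n, (if (i : ℕ) < k then (0 : ℝ) else 1) * g i ^ 2 :=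
      Finset.sum_congr rfl fun i _ => by split_ifs <;> simp
    have h2 : ∑ i : Fin n, (1 - s * x + if (i : ℕ) < k then 0 else s) * g i ^ 2
        = (1 - s * x) * ∑ i, g i ^ 2
          + s * ∑ i : Fin n, (if (i : ℕ) < k then 0 else 1) * g i ^ 2 := by
      rw [Finset.mul_sum, Finset.mul_sum, ← Finset.sum_add_distrib]
      exact Finset.sum_congr rfl fun i _ => by split_ifs <;> ring
    rw [h2, this, EuclideanSpace.real_norm_sq_eq]
    ring
  simp only [e1, e2] at h
  rw [lintegral_exp_neg_weighted_sum_sq _ (fun _ => one_pos),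
    lintegral_exp_neg_weighted_sum_sq _ hw] at h
  have h' := ENNReal.toReal_mono ENNReal.ofReal_ne_top h
  rw [ENNReal.toReal_mul, ENNReal.toReal_ofReal (by positivity),
    ENNReal.toReal_ofReal (by positivity)] at h'
  have h3 : ∏ i : Fin n, √(Real.pi / (1 - s * x + if (i : ℕ) < k then 0 else s))
      = (∏ i : Fin n, √((1 - s * x + if (i : ℕ) < k then 0 else s)⁻¹))
        * ∏ i : Fin n, √(Real.pi / 1) := by
    rw [← Finset.prod_mul_distrib]
    refine Finset.prod_congr rfl fun i _ => ?_
    rw [← Real.sqrt_mul (inv_nonneg.mpr (hw i).le), div_one, div_eq_inv_mul]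
  rw [h3] at h'
  exact le_of_mul_le_mul_right h' (by positivity)

theorem prod_ite_val_lt {n k : ℕ} (h : k ≤ n) (a b : ℝ) :
    ∏ i : Fin n, (if (i : ℕ) < k then a else b) = a ^ k * b ^ (n - k) := by
  rw [Fin.prod_univ_eq_prod_range (fun i => if i < k then a else b) n]
  obtain ⟨d, rfl⟩ := Nat.exists_eq_add_of_le h
  rw [Finset.prod_range_add]
  simp only [Nat.add_sub_cancel_left, Nat.not_lt.mpr (Nat.le_add_right k _), if_false,
    Finset.prod_const, Finset.card_range]
  congr 1
  rw [Finset.prod_congr rfl fun i hi => if_pos (Finset.mem_range.mp hi)]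
  simp

/-- A uniformly random unit vector is unlikely to be close to a fixed subspace. -/
theorem orthHaar_tailSq_lt_le_pow {n k : ℕ} (h : k < n) {u : Feat n} (hu : ‖u‖ = 1) {t : ℝ}
    (ht : 0 < t) :
    (orthHaar n).real {U | tailSq k (((U⁻¹ : OrthGroup n) : Feat n →L[ℝ] Feat n) u) < t ^ 2}
      ≤ (3 * t / √(1 - (k : ℝ) / n)) ^ (n - k) := by
  have hn : (0 : ℝ) < n := by exact_mod_cast (Nat.zero_le k).trans_lt h
  have hkn : (k : ℝ) < n := by exact_mod_cast h
  set δ : ℝ := 1 - k / n with hδ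
  have hk0 : 0 ≤ (k : ℝ) / n := by positivity
  have hδ0 : 0 < δ := sub_pos.mpr ((div_lt_one hn).mpr hkn)
  have hδ1 : δ ≤ 1 := by linarith
  have hδn : δ * n = (n - k : ℕ) := by
    rw [Nat.cast_sub h.le, hδ]
    field_simp
  -- The Chernoff parameter `s` is chosen so that `s * t ^ 2 = δ / 2`.
  have hs : 0 ≤ δ / (2 * t ^ 2) := by positivity
  have hsx : δ / (2 * t ^ 2) * t ^ 2 = δ / 2 := by field_simp
  -- Rests on `1 ≤ (1 + δ) * (1 - δ / 2)`, valid for `0 ≤ δ ≤ 1`.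
  have hlow : √((1 - δ / 2)⁻¹) ≤ Real.exp (δ / 2) := by
    rw [Real.sqrt_le_left (Real.exp_pos _).le, ← Real.exp_nat_mul]
    rw [inv_le_comm₀ (by linarith) (Real.exp_pos _), ← Real.exp_neg]
    have h1 := Real.add_one_le_exp δ
    rw [Real.exp_neg, inv_le_comm₀ (Real.exp_pos _) (by linarith)]
    refine le_trans ?_ (Real.add_one_le_exp _)
    rw [inv_le_iff_one_le_mul₀ (by linarith)]
    push_cast
    nlinarith
  have hhigh : √((1 - δ / 2 + δ / (2 * t ^ 2))⁻¹) ≤ √2 * t / √δ := by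
    have : √2 * t / √δ = √((δ / (2 * t ^ 2))⁻¹) := by
      rw [inv_div, Real.sqrt_div (by positivity), Real.sqrt_mul (by norm_num),
        Real.sqrt_sq ht.le]
    rw [this]
    exact Real.sqrt_le_sqrt (inv_anti₀ (by positivity) (by linarith))
  -- Since `δ * k ≤ δ * n = n - k`, the first `k` factors cost only a constant per codimension.
  have hexp : Real.exp (δ / 2) ^ k ≤ Real.exp (1 / 2) ^ (n - k) := by
    rw [← Real.exp_nat_mul, ← Real.exp_nat_mul, Real.exp_le_exp, ← hδn]
    nlinarith
  -- The source of the constant 3: `2 * e ≤ 9`.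
  have hconst : Real.exp (1 / 2) * √2 ≤ 3 := by
    refine (sq_le_sq₀ (by positivity) (by norm_num)).mp ?_
    rw [mul_pow, Real.sq_sqrt (by norm_num), ← Real.exp_nat_mul]
    have := Real.exp_one_lt_d9
    norm_num
    linarith
  calc _ ≤ ∏ i : Fin n, √((1 - δ / (2 * t ^ 2) * t ^ 2
            + if (i : ℕ) < k then 0 else δ / (2 * t ^ 2))⁻¹) :=
        orthHaar_tailSq_lt_le_prod k hu hs (by linarith)
    _ ≤ ∏ i : Fin n, (if (i : ℕ) < k then Real.exp (δ / 2) else √2 * t / √δ) := by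
        refine Finset.prod_le_prod (fun i _ => Real.sqrt_nonneg _) fun i _ => ?_
        rw [hsx]
        split_ifs
        · simpa using hlow
        · exact hhigh
    _ = Real.exp (δ / 2) ^ k * (√2 * t / √δ) ^ (n - k) := prod_ite_val_lt h.le _ _
    _ ≤ Real.exp (1 / 2) ^ (n - k) * (√2 * t / √δ) ^ (n - k) := by gcongr
    _ = (Real.exp (1 / 2) * √2 * t / √δ) ^ (n - k) := by rw [← mul_pow]; congr 1; ring
    _ ≤ (3 * t / √δ) ^ (n - k) := by gcongr

/-! ### From random vectors to random subspaces -/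

/-- A uniformly random subspace is unlikely to come close to a fixed nonzero vector. -/
theorem uniformSubspace_exists_dist_lt_le {n k : ℕ} (h : k < n) {w : Feat n} {r τ : ℝ}
    (hr : 0 < r) (hw : r ≤ ‖w‖) (hτ : 0 < τ) :
    (uniformSubspace h.le).real {S | ∃ v ∈ S.1, ‖w - v‖ < τ}
      ≤ (3 * τ / (r * √(1 - (k : ℝ) / n))) ^ (n - k) := by
  have hw0 : 0 < ‖w‖ := hr.trans_le hw
  -- The projection attains the distance, so the event is open, hence measurable, as the pushforward
  -- formula requires.
  have hset : {S : Grass n k | ∃ v ∈ S.1, ‖w - v‖ < τ}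
      = {S : Grass n k | ‖w - S.1.starProjection w‖ < τ} := by
    ext S
    constructor
    · rintro ⟨v, hv, hlt⟩
      refine lt_of_le_of_lt ?_ hlt
      rw [Submodule.starProjection_minimal]
      exact ciInf_le ⟨0, by rintro _ ⟨y, rfl⟩; exact norm_nonneg _⟩ (⟨v, hv⟩ : S.1)
    · exact fun hlt => ⟨_, Submodule.starProjection_apply_mem _ _, hlt⟩
  have hm : MeasurableSet {S : Grass n k | ∃ v ∈ S.1, ‖w - v‖ < τ} := by
    rw [hset]
    have hc : Continuous fun S : Grass n k => S.1.starProjection := continuous_induced_dom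
    exact (isOpen_lt (continuous_const.sub (hc.clm_apply continuous_const)).norm
      continuous_const).measurableSet
  have hsub : rotatedSubspace h.le ⁻¹' {S : Grass n k | ∃ v ∈ S.1, ‖w - v‖ < τ}
      ⊆ {U | tailSq k (((U⁻¹ : OrthGroup n) : Feat n →L[ℝ] Feat n) (‖w‖⁻¹ • w))
          < (τ / r) ^ 2} := by
    rintro U ⟨_, ⟨v, hv, rfl⟩, hlt⟩
    have h1 : ‖((U⁻¹ : OrthGroup n) : Feat n →L[ℝ] Feat n) w - v‖ < τ := by
      rw [← Unitary.norm_map U]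
      have h2 : (U : Feat n →L[ℝ] Feat n) (((U⁻¹ : OrthGroup n) : Feat n →L[ℝ] Feat n) w) = w := by
        change ((U * U⁻¹ : OrthGroup n) : Feat n →L[ℝ] Feat n) w = w
        rw [mul_inv_cancel]
        rfl
      rw [map_sub, h2]
      exact hlt
    have h3 := (tailSq_le_norm_sub_sq (((U⁻¹ : OrthGroup n) : Feat n →L[ℝ] Feat n) w) hv).trans_lt
      (pow_lt_pow_left₀ h1 (norm_nonneg _) two_ne_zero)
    simp only [Set.mem_ofPred_eq, map_smul, tailSq_smul]
    calc _ < ‖w‖⁻¹ ^ 2 * τ ^ 2 := by gcongr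
      _ ≤ r⁻¹ ^ 2 * τ ^ 2 := by gcongr
      _ = (τ / r) ^ 2 := by rw [div_pow, inv_pow, div_eq_inv_mul]
  rw [uniformSubspace, map_measureReal_apply (continuous_rotatedSubspace h.le).measurable hm]
  refine (measureReal_mono hsub).trans ((orthHaar_tailSq_lt_le_pow h ?_ (by positivity)).trans ?_)
  · rw [norm_smul, norm_inv, norm_norm, inv_mul_cancel₀ hw0.ne']
  · refine le_of_eq ?_
    congr 1
    field_simp

end

theorem mainTheorem2 :
    ∃ c c₀ : ℝ, 0 < c ∧ 0 < c₀ ∧ c₀ < 1 ∧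
      ∀ {𝒳 𝒴 : Type*} (n₂ n₃ m : ℕ) (hn : n₃ < n₂) (F : 𝒳 → Feat n₂)
        (train : Fin m → 𝒳) (lab : Fin m → 𝒴) (x : 𝒳) (y : 𝒴) (r τ : ℝ)
        (_hr : IsLeast {d | ∃ i, lab i ≠ y ∧ d = dist (F x) (F (train i))} r)
        (_hr0 : 0 < r) (_hτ : 0 ≤ τ) (f : Feat n₂ → Option 𝒴)
        (_hf : IsRobustClassifier τ 0 (fun i => F (train i)) lab f),
        robustError (uniformSubspace hn.le) f (F x) y ≤
          m * (c * τ / (r * Real.sqrt (1 - (n₃ : ℝ) / n₂))) ^ (n₂ - n₃) + m * c₀ ^ (n₂ - n₃) := by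
  -- The first term alone bounds the error, so `c₀ = 1 / 2` is arbitrary.
  refine ⟨3, 1 / 2, by norm_num, by norm_num, by norm_num, ?_⟩
  intro 𝒳 𝒴 n₂ n₃ m hn F train lab x y r τ hr hr0 hτ f hf
  have hsub : {S : Grass n₂ n₃ | ∃ v ∈ S.1, f (v + F x) ≠ some y ∧ f (v + F x) ≠ none}
      ⊆ ⋃ i : Fin m, {S | lab i ≠ y ∧ ∃ v ∈ S.1, ‖(F (train i) - F x) - v‖ < τ} := by
    rintro S ⟨v, hv, hy, hnone⟩
    have hex := not_imp_comm.mp (hf.abstains (v + F x)) hnone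
    obtain ⟨i, -, hmin, hi⟩ := hf.predicts _ hex
    obtain ⟨j, hj, hlt⟩ := hex
    refine Set.mem_iUnion.mpr ⟨i, fun hiy => hy (hiy ▸ hi), v, hv, ?_⟩
    have := (hmin j hj).trans_lt hlt
    rwa [dist_eq_norm, norm_sub_rev, add_comm v, ← sub_sub] at this
  have hi : ∀ i : Fin m, (uniformSubspace hn.le).real
      {S | lab i ≠ y ∧ ∃ v ∈ S.1, ‖(F (train i) - F x) - v‖ < τ}
        ≤ (3 * τ / (r * √(1 - (n₃ : ℝ) / n₂))) ^ (n₂ - n₃) := by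
    intro i
    have h0 : 0 ≤ (3 * τ / (r * √(1 - (n₃ : ℝ) / n₂))) ^ (n₂ - n₃) := by positivity
    by_cases hiy : lab i = y
    · simp [hiy, h0]
    -- For `τ = 0` the strict inequality makes the event empty.
    rcases hτ.eq_or_lt with rfl | hτ'
    · simp [not_lt.mpr (norm_nonneg _)]
    · simp only [ne_eq, hiy, not_false_eq_true, true_and]
      refine uniformSubspace_exists_dist_lt_le hn hr0 ?_ hτ'
      rw [← dist_eq_norm, dist_comm]
      exact hr.2 ⟨i, hiy, rfl⟩
  calc robustError (uniformSubspace hn.le) f (F x) y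
      ≤ (uniformSubspace hn.le).real
        (⋃ i : Fin m, {S | lab i ≠ y ∧ ∃ v ∈ S.1, ‖(F (train i) - F x) - v‖ < τ}) :=
        measureReal_mono hsub
    _ ≤ ∑ i : Fin m, (uniformSubspace hn.le).real
        {S | lab i ≠ y ∧ ∃ v ∈ S.1, ‖(F (train i) - F x) - v‖ < τ} :=
        measureReal_iUnion_fintype_le _
    _ ≤ ∑ _i : Fin m, (3 * τ / (r * √(1 - (n₃ : ℝ) / n₂))) ^ (n₂ - n₃) :=
        Finset.sum_le_sum fun i _ => hi i
    _ = m * (3 * τ / (r * √(1 - (n₃ : ℝ) / n₂))) ^ (n₂ - n₃) := by simp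
    _ ≤ _ := le_add_of_nonneg_right (by positivity)
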